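/- **Theorem (Elton's Ergodic Theorem for GIFS).** Let $(X,d)$ be a non-empty compact metric space, let $m,n\ge 1$, and equip $X^m$ with the maximum metric. Let $\mathcal S=(X,(\phi_j)_{j=0}^{n-1},(p_j)_{j=0}^{n-1})$ be a generalized iterated function system with place-dependent probabilities of degree $m$: the maps $\phi_j:X^m\to X$ and the weights $p_j:X^m\to[0,1]$ are continuous and $\sum_j p_j\equiv 1$. Assume * (E1) for each $j$ there are $a_{j,0},\dots,a_{j,m-1}>0$ with $\sum_i a_{j,i}<1$ and $d(\phi_j(x),\phi_j(y))\le\sum_i a_{j,i}\,d(x_i,y_i)$ for all $x,y\in X^m$; * (E2) there is $\delta>0$ with $p_j(x)\ge\delta$ for all $j$ and all $x\in X^m$, and for each $j$ there are $c_{j,0},\dots,c_{j,m-1}>0$ with $\sum_i c_{j,i}<1$ and $|p_j(x)-p_j(y)|\le\sum_i c_{j,i}\,d(x_i,y_i)$ for all $x,y\in X^m$. For $x=(x_0,\dots,x_{m-1})\in X^m$ and $w=(w_0,w_1,\dots)\in\Omega=\{0,\dots,n-1\}^{\mathbb N}$ let $(x_k(w))_{k\ge0}$ be the orbit given by $x_k(w)=x_k$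 for $k<m$ and $x_{k+m}(w)=\phi_{w_k}(x_k(w),\dots,x_{k+m-1}(w))$ for $k\ge 0$, and let $P_x$ be the Borel probability on $\Omega$ that gives each cylinder the mass $$P_x(\overline{w_0\cdots w_{k-1}})=\prod_{l=0}^{k-1}p_{w_l}(x_l(w),\dots,x_{l+m-1}(w)).$$ Let $\hat\phi_j(x_0,\dots,x_{m-1})=(x_1,\dots,x_{m-1},\phi_j(x_0,\dots,x_{m-1}))$, and let $\mathcal L_{\hat{\mathcal S}}$ be the Markov operator on Borel probabilities on $X^m$ with $\int g\,d\mathcal L_{\hat{\mathcal S}}(\alpha)=\int\sum_j p_j\,(g\circ\hat\phi_j)\,d\alpha$ for all continuous $g:X^m\to\mathbb R$. Then $\mathcal L_{\hat{\mathcal S}}$ has a unique fixed point $\alpha$ (the extended Hutchinson measure), all $m$ marginals of $\alpha$ on $X$ are equal to one probability $\mu_\alpha$ (the projected Hutchinson measure), and for each $x\in X^m$ there is a measurable set $\Omega_x\subseteq\Omega$ with $P_x(\Omega_x)=1$ such that for every $w\in\Omega_x$ and every continuous $f:X\to\mathbb R$, $$\frac1K\sum_{k=0}^{K-1}f(x_k(w))\longrightarrow\int_X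 f\,d\mu_\alpha\qquad(K\to\infty).$$ -/

import Mathlib

open MeasureTheory ProbabilityTheory Filter Topology
open scoped ENNReal

/-- A (continuous) generalized iterated function system with place dependent probabilities, of
degree `m` and with `n` maps: continuous maps `φ j : X ^ m → X` and continuous weights
`p j : X ^ m → [0, 1]` that sum to `1`. The space `X ^ m = (Fin m → X)` carries the maximum
metric. -/
structure GIFSpdp (X : Type*) [MetricSpace X] (m n : ℕ) where
  /-- the maps -/
  φ : Fin n → C(Fin m → X, X)
  /-- the weights -/
  p : Fin n → C(Fin m → X, ℝ)
  p_mem : ∀ j x, p j x ∈ Set.Icc (0 : ℝ) 1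
  p_sum : ∀ x, ∑ j, p j x = 1

/-- `f : X ^ m → Y` satisfies `d (f x, f y) ≤ ∑ i, a i * d (x i, y i)`, with all `a i > 0`. -/
def LipWith {X Y : Type*} [MetricSpace X] [MetricSpace Y] {m : ℕ} (a : Fin m → ℝ)
    (f : (Fin m → X) → Y) : Prop :=
  (∀ i, 0 < a i) ∧ ∀ x y, dist (f x) (f y) ≤ ∑ i, a i * dist (x i) (y i)

namespace GIFSpdp

variable {X : Type*} [MetricSpace X] {m n : ℕ}

/-- Contraction hypothesis on the maps. -/
def E1 (S : GIFSpdp X m n) : Prop :=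
  ∀ j, ∃ a : Fin m → ℝ, LipWith a (S.φ j) ∧ ∑ i, a i < 1

/-- Hypothesis on the weights: bounded away from `0`, and Lipschitz. -/
def E2 (S : GIFSpdp X m n) : Prop :=
  (∃ δ : ℝ, 0 < δ ∧ ∀ j x, δ ≤ S.p j x) ∧
    ∀ j, ∃ c : Fin m → ℝ, LipWith c (S.p j) ∧ ∑ i, c i < 1

/-- The orbit of `x = (x_0, …, x_{m-1})` along the symbol sequence `w`: it starts with
`x_0, …, x_{m-1}`, and `x_{k+m} = φ_{w_k} (x_k, …, x_{k+m-1})` (see `orbit_add`). -/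
def orbit (S : GIFSpdp X m n) (x : Fin m → X) (w : ℕ → Fin n) (k : ℕ) : X :=
  if h : k < m then x ⟨k, h⟩
  else S.φ (w (k - m)) fun i : Fin m => S.orbit x w (k - m + i)
termination_by k
decreasing_by omega

/-- The block `(x_k, …, x_{k+m-1})` of the orbit. -/
def block (S : GIFSpdp X m n) (x : Fin m → X) (w : ℕ → Fin n) (k : ℕ) : Fin m → X :=
  fun i => S.orbit x w (k + i)

theorem orbit_of_lt (S : GIFSpdp X m n) (x : Fin m → X) (w : ℕ → Fin n) (i : Fin m) :
    S.orbit x w i = x i := by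
  rw [orbit, dif_pos i.2]

theorem orbit_add (S : GIFSpdp X m n) (x : Fin m → X) (w : ℕ → Fin n) (k : ℕ) :
    S.orbit x w (k + m) = S.φ (w k) (S.block x w k) := by
  rw [orbit, dif_neg (by omega)]
  simp only [Nat.add_sub_cancel]
  rfl

theorem orbit_congr (S : GIFSpdp X m n) (x : Fin m → X) {w v : ℕ → Fin n} (k : ℕ)
    (h : ∀ l, l + m ≤ k → w l = v l) : S.orbit x w k = S.orbit x v k := by
  induction k using Nat.strong_induction_on with
  | _ k ih =>
    by_cases hk : k < m
    · have h1 := S.orbit_of_lt x w ⟨k, hk⟩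
      have h2 := S.orbit_of_lt x v ⟨k, hk⟩
      exact h1.trans h2.symm
    · obtain ⟨l, rfl⟩ : ∃ l, k = l + m := ⟨k - m, by omega⟩
      rw [orbit_add, orbit_add, h l le_rfl]
      congr 1
      funext i
      exact ih (l + i) (by omega) fun q hq => h q (by omega)

theorem block_congr (S : GIFSpdp X m n) (x : Fin m → X) {w v : ℕ → Fin n} (k : ℕ)
    (h : ∀ l, l < k → w l = v l) : S.block x w k = S.block x v k := by
  funext i
  exact S.orbit_congr x _ fun l hl => h l (by omega)

/-- The maps `φ̂_j (x_0, …, x_{m-1}) = (x_1, …, x_{m-1}, φ_j (x_0, …, x_{m-1}))` of the extension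
of `S` to an iterated function system on `X ^ m`. -/
def extMap (S : GIFSpdp X m n) (j : Fin n) (x : Fin m → X) : Fin m → X :=
  fun i => if h : (i : ℕ) + 1 < m then x ⟨i + 1, h⟩ else S.φ j x

theorem continuous_extMap (S : GIFSpdp X m n) (j : Fin n) : Continuous (S.extMap j) := by
  refine continuous_pi fun i => ?_
  unfold extMap
  split_ifs
  · fun_prop
  · exact (S.φ j).continuous

theorem block_zero (S : GIFSpdp X m n) (x : Fin m → X) (w : ℕ → Fin n) : S.block x w 0 = x := by
  funext i
  simpa [block] using S.orbit_of_lt x w i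

/-- The blocks of the orbit of `S` are the orbit of the extension. -/
theorem block_succ (S : GIFSpdp X m n) (x : Fin m → X) (w : ℕ → Fin n) (k : ℕ) :
    S.block x w (k + 1) = S.extMap (w k) (S.block x w k) := by
  funext i
  unfold extMap
  split_ifs with h
  · simp only [block]
    congr 1
    omega
  · rw [← orbit_add, block]
    congr 1
    omega

/-- The transfer operator `B̂ g (x) = ∑ j, p_j (x) g (φ̂_j (x))` of the extension. -/
noncomputable def extTransfer (S : GIFSpdp X m n) (g : C(Fin m → X, ℝ)) : C(Fin m → X, ℝ) :=
  ∑ j, S.p j * g.comp ⟨S.extMap j, S.continuous_extMap j⟩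

theorem extTransfer_apply (S : GIFSpdp X m n) (g : C(Fin m → X, ℝ)) (x : Fin m → X) :
    S.extTransfer g x = ∑ j, S.p j x * g (S.extMap j x) := by
  simp [extTransfer]

theorem sum_ofReal_p (S : GIFSpdp X m n) (x : Fin m → X) :
    ∑ j, ENNReal.ofReal (S.p j x) = 1 := by
  rw [← ENNReal.ofReal_sum_of_nonneg fun j _ => (S.p_mem j x).1, S.p_sum, ENNReal.ofReal_one]

section Markov

variable [CompactSpace X] [MeasurableSpace X] [BorelSpace X]

/-- The Markov operator of the extension, on measures: the image of `α` is
`∑ j, (φ̂_j)_* (p_j α)`. -/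
noncomputable def extMarkovMeasure (S : GIFSpdp X m n) (α : Measure (Fin m → X)) :
    Measure (Fin m → X) :=
  ∑ j, (α.withDensity fun x => ENNReal.ofReal (S.p j x)).map (S.extMap j)

theorem isProbabilityMeasure_extMarkovMeasure (S : GIFSpdp X m n) (α : Measure (Fin m → X))
    [IsProbabilityMeasure α] : IsProbabilityMeasure (S.extMarkovMeasure α) := by
  constructor
  have hp : ∀ j, Measurable fun x => ENNReal.ofReal (S.p j x) := fun j =>
    ((S.p j).continuous.measurable).ennreal_ofReal
  simp only [extMarkovMeasure, Measure.coe_finsetSum, Finset.sum_apply]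
  have : ∀ j, ((α.withDensity fun x => ENNReal.ofReal (S.p j x)).map (S.extMap j)) Set.univ
      = ∫⁻ x, ENNReal.ofReal (S.p j x) ∂α := fun j => by
    rw [Measure.map_apply (S.continuous_extMap j).measurable .univ, Set.preimage_univ,
      withDensity_apply _ .univ, Measure.restrict_univ]
  simp only [this]
  rw [← lintegral_finsetSum _ fun j _ => hp j]
  simp [S.sum_ofReal_p]

/-- The Markov operator `L̂ : Prob (X ^ m) → Prob (X ^ m)` of the extension. -/
noncomputable def extMarkov (S : GIFSpdp X m n) (α : ProbabilityMeasure (Fin m → X)) :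
    ProbabilityMeasure (Fin m → X) :=
  ⟨S.extMarkovMeasure (α : Measure (Fin m → X)),
    S.isProbabilityMeasure_extMarkovMeasure (α : Measure (Fin m → X))⟩

/-- The duality that characterizes the Markov operator: `∫ g d(L̂ α) = ∫ B̂ g dα`. -/
theorem integral_extMarkov (S : GIFSpdp X m n) (α : ProbabilityMeasure (Fin m → X))
    (g : C(Fin m → X, ℝ)) :
    ∫ x, g x ∂(S.extMarkov α : Measure (Fin m → X)) =
      ∫ x, S.extTransfer g x ∂(α : Measure (Fin m → X)) := by
  have hInt : ∀ f : C(Fin m → X, ℝ), ∀ ν : Measure (Fin m → X), [IsFiniteMeasure ν] →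
      Integrable (fun x => f x) ν := fun f ν _ =>
    f.continuous.integrable_of_hasCompactSupport (HasCompactSupport.of_compactSpace _)
  have hfin : ∀ j, IsFiniteMeasure ((α : Measure (Fin m → X)).withDensity fun x =>
      ENNReal.ofReal (S.p j x)) := fun j =>
    isFiniteMeasure_withDensity_ofReal (hInt (S.p j) _).2
  have h0 : (S.extMarkov α : Measure (Fin m → X)) = ∑ j,
      ((α : Measure (Fin m → X)).withDensity fun x => ENNReal.ofReal (S.p j x)).map
        (S.extMap j) := rfl
  rw [h0, integral_finsetSum_measure fun j _ => hInt g _]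
  simp only [extTransfer_apply]
  have hprod : ∀ j, Integrable (fun x => S.p j x * g (S.extMap j x))
      (α : Measure (Fin m → X)) := fun j =>
    hInt (S.p j * g.comp ⟨S.extMap j, S.continuous_extMap j⟩) _
  rw [integral_finsetSum _ fun j _ => hprod j]
  refine Finset.sum_congr rfl fun j _ => ?_
  rw [integral_map (S.continuous_extMap j).measurable.aemeasurable
    g.continuous.aestronglyMeasurable]
  have hd := integral_withDensity_eq_integral_toReal_smul
    (μ := (α : Measure (Fin m → X))) (f := fun x => ENNReal.ofReal (S.p j x))
    ((S.p j).continuous.measurable.ennreal_ofReal) (by simp) (fun x => g (S.extMap j x))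
  rw [hd]
  refine integral_congr_ae (Eventually.of_forall fun x => ?_)
  simp [ENNReal.toReal_ofReal (S.p_mem j x).1]

/-- `α` is the extended Hutchinson measure of `S`: the unique fixed point of the Markov operator
of the extension. -/
def IsExtendedHutchinson (S : GIFSpdp X m n) (α : ProbabilityMeasure (Fin m → X)) : Prop :=
  S.extMarkov α = α ∧ ∀ β, S.extMarkov β = β → β = α

end Markov

/-- The law on symbols at the state `x`: the symbol `j` has probability `p_j (x)`. -/
noncomputable def symbolLaw (S : GIFSpdp X m n) (x : Fin m → X) : Measure (Fin n) :=
  ∑ j, ENNReal.ofReal (S.p j x) • Measure.dirac j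

instance (S : GIFSpdp X m n) (x : Fin m → X) : IsProbabilityMeasure (S.symbolLaw x) := by
  constructor
  simp [symbolLaw, S.sum_ofReal_p]

theorem symbolLaw_singleton (S : GIFSpdp X m n) (x : Fin m → X) (j : Fin n) :
    S.symbolLaw x {j} = ENNReal.ofReal (S.p j x) := by
  classical
  simp [symbolLaw, Set.indicator_apply]

/-- Some infinite word that starts with the given symbols `v_0, …, v_k`. -/
def extendWord {k : ℕ} (v : Finset.Iic k → Fin n) : ℕ → Fin n :=
  fun l => if h : l ≤ k then v ⟨l, Finset.mem_Iic.2 h⟩ else v ⟨0, Finset.mem_Iic.2 k.zero_le⟩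

/-- The law of the symbol `w_{k+1}` given `w_0, …, w_k`, when the orbit starts at `x`: it is
`j ↦ p_j (x_{k+1}, …, x_{k+m})`. -/
noncomputable def symbolKernel (S : GIFSpdp X m n) (x : Fin m → X) (k : ℕ) :
    Kernel (Finset.Iic k → Fin n) (Fin n) where
  toFun v := S.symbolLaw (S.block x (extendWord v) (k + 1))
  measurable' := Measurable.of_discrete

instance (S : GIFSpdp X m n) (x : Fin m → X) (k : ℕ) : IsMarkovKernel (S.symbolKernel x k) :=
  ⟨fun v => inferInstanceAs
    (IsProbabilityMeasure (S.symbolLaw (S.block x (extendWord v) (k + 1))))⟩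

/-- The probability `P_x` on the space of symbol sequences; it is determined by its values on
cylinders, see `symbolMeasure_cylinder`. -/
noncomputable def symbolMeasure (S : GIFSpdp X m n) (x : Fin m → X) : Measure (ℕ → Fin n) :=
  Kernel.trajMeasure (X := fun _ => Fin n) (S.symbolLaw x) (S.symbolKernel x)

instance (S : GIFSpdp X m n) (x : Fin m → X) : IsProbabilityMeasure (S.symbolMeasure x) :=
  inferInstanceAs (IsProbabilityMeasure
    (Kernel.trajMeasure (X := fun _ => Fin n) (S.symbolLaw x) (S.symbolKernel x)))

theorem symbolMeasure_map_zero (S : GIFSpdp X m n) (x : Fin m → X) :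
    (S.symbolMeasure x).map (fun w => w 0) = S.symbolLaw x := by
  have h : (fun w : ℕ → Fin n => w 0) =
      (fun v : Finset.Iic 0 → Fin n => v ⟨0, Finset.mem_Iic.2 le_rfl⟩) ∘
        Preorder.frestrictLe (π := fun _ => Fin n) 0 := rfl
  rw [h, ← Measure.map_map (by fun_prop) (by fun_prop), symbolMeasure, Kernel.trajMeasure,
    Measure.map_comp _ _ (by fun_prop), Kernel.traj_map_frestrictLe, Kernel.partialTraj_self,
    Measure.id_comp, Measure.map_map (by fun_prop) (by fun_prop)]
  exact Measure.map_id

/-- `P_x` of the cylinder of `w_0 ⋯ w_{k-1}` is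
`p_{w_0} (x_0, …, x_{m-1}) ⋯ p_{w_{k-1}} (x_{k-1}, …, x_{k+m-2})`. -/
theorem symbolMeasure_cylinder (S : GIFSpdp X m n) (x : Fin m → X) (w : ℕ → Fin n) (k : ℕ) :
    S.symbolMeasure x {v | ∀ l < k, v l = w l} =
      ∏ l ∈ Finset.range k, ENNReal.ofReal (S.p (w l) (S.block x w l)) := by
  induction k with
  | zero => simp
  | succ k ih =>
    cases k with
    | zero =>
      have h : {v : ℕ → Fin n | ∀ l < 0 + 1, v l = w l} = (fun v => v 0) ⁻¹' {w 0} := by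
        ext v
        simp
      rw [h, ← Measure.map_apply (by fun_prop) (measurableSet_singleton _),
        symbolMeasure_map_zero, symbolLaw_singleton]
      simp [block_zero]
    | succ a =>
      rw [Finset.prod_range_succ, ← ih]
      set r : (ℕ → Fin n) → (Finset.Iic a → Fin n) :=
        Preorder.frestrictLe (π := fun _ => Fin n) a with hr
      have hrm : Measurable r := by fun_prop
      have hset : {v : ℕ → Fin n | ∀ l < a + 1, v l = w l} = r ⁻¹' {r w} := by
        ext v
        simp only [Set.mem_ofPred_eq, Set.mem_preimage, Set.mem_singleton_iff, funext_iff]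
        exact ⟨fun h i => h i (Nat.lt_succ_of_le (Finset.mem_Iic.1 i.2)),
          fun h l hl => h ⟨l, Finset.mem_Iic.2 (Nat.le_of_lt_succ hl)⟩⟩
      have hset' : {v : ℕ → Fin n | ∀ l < a + 1 + 1, v l = w l} =
          (fun v => (r v, v (a + 1))) ⁻¹' ({r w} ×ˢ {w (a + 1)}) := by
        ext v
        have h := Set.ext_iff.1 hset v
        simp only [Set.mem_ofPred_eq, Set.mem_preimage, Set.mem_singleton_iff] at h
        simp only [Set.mem_ofPred_eq, Set.mem_preimage, Set.mem_prod, Set.mem_singleton_iff, ← h]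
        exact ⟨fun h => ⟨fun l hl => h l (by omega), h _ (by omega)⟩, fun h l hl => by
          rcases Nat.lt_succ_iff_lt_or_eq.1 hl with h' | h'
          · exact h.1 l h'
          · exact h' ▸ h.2⟩
      have key : (S.symbolMeasure x).map r ⊗ₘ S.symbolKernel x a =
          (S.symbolMeasure x).map (fun v => (r v, v (a + 1))) :=
        Kernel.map_frestrictLe_trajMeasure_compProd_eq_map_trajMeasure
          (X := fun _ => Fin n) (μ₀ := S.symbolLaw x) (κ := S.symbolKernel x)
      have hP : IsProbabilityMeasure ((S.symbolMeasure x).map r) :=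
        Measure.isProbabilityMeasure_map hrm.aemeasurable
      rw [hset', ← Measure.map_apply (by fun_prop)
        ((measurableSet_singleton _).prod (measurableSet_singleton _)), ← key,
        Measure.compProd_apply_prod (measurableSet_singleton _) (measurableSet_singleton _),
        Measure.restrict_singleton, lintegral_smul_measure, lintegral_dirac, hset,
        Measure.map_apply hrm (measurableSet_singleton _), smul_eq_mul]
      congr 1
      change S.symbolLaw (S.block x (extendWord (r w)) (a + 1)) {w (a + 1)} = _
      rw [symbolLaw_singleton, S.block_congr x (v := w) (a + 1)]
      intro l hl
      simp [extendWord, hr, Nat.le_of_lt_succ hl]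

end GIFSpdp

/-! The blocks of an orbit form a random orbit of the extension to `X ^ m`. Its maps contract
`max_i r ^ i * d (x_i, y_i)` for some `r > 1`: the shift gains a factor `r⁻¹` in the first `m - 1`
coordinates, and the contraction of `φ_j` does so in the last one when `r` is close to `1`.
A Lasota–Yorke estimate bounds the modulus of continuity of all iterates `B̂ ^ N g` at once. With
positive probability two copies of the random orbit apply the same map many times in a row and so
come close to each other; hence the oscillation of `B̂ ^ N g` tends to `0`, and `B̂ ^ N g` converges
uniformly to a constant, which is the integral of `g` against the unique fixed point of `L̂`.

Along the blocks `Y_k`, the differences `B̂ g (Y_k) - g (Y_{k+1})` are bounded and pairwise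
orthogonal, so by a strong law of large numbers their averages tend to `0` almost surely. The time
averages of `g` and of every `B̂ ^ N g` therefore agree asymptotically, and the latter are uniformly
close to the constant. As `C(X)` is separable, one null set serves all `f`. -/

open scoped NNReal

theorem tendsto_zero_of_antitone_of_contracting {a : ℕ → ℝ} (hanti : Antitone a)
    (hnonneg : ∀ N, 0 ≤ a N)
    (hcontr : ∀ ε > 0, ∃ k, ∃ δ > 0, ∀ N, a (N + k) ≤ (1 - δ) * a N + δ * ε) :
    Tendsto a atTop (𝓝 0) := by
  have hlim : Tendsto a atTop (𝓝 (⨅ N, a N)) :=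
    tendsto_atTop_ciInf hanti ⟨0, Set.forall_mem_range.2 hnonneg⟩
  suffices h : ⨅ N, a N = 0 by rwa [h] at hlim
  refine le_antisymm (le_of_forall_pos_le_add fun ε hε => ?_) (le_ciInf hnonneg)
  obtain ⟨k, δ, hδ, hk⟩ := hcontr ε hε
  have hle := le_of_tendsto_of_tendsto' ((tendsto_add_atTop_iff_nat k).2 hlim)
    ((hlim.const_mul (1 - δ)).add_const (δ * ε)) hk
  exact le_of_mul_le_mul_left (by linarith) hδ

section RangeDiam

variable {Y : Type*} [TopologicalSpace Y]

/-- The oscillation `sup g - inf g`. As a diameter, it is `0` when `g` is unbounded. -/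
noncomputable def rangeDiam (g : C(Y, ℝ)) : ℝ :=
  Metric.diam (Set.range g)

theorem rangeDiam_nonneg (g : C(Y, ℝ)) : 0 ≤ rangeDiam g :=
  Metric.diam_nonneg

theorem rangeDiam_le [Nonempty Y] {g : C(Y, ℝ)} {C : ℝ} (h : ∀ x y, g x - g y ≤ C) :
    rangeDiam g ≤ C := by
  refine Metric.diam_le_of_forall_dist_le_of_nonempty (Set.range_nonempty g) ?_
  rintro _ ⟨x, rfl⟩ _ ⟨y, rfl⟩
  exact abs_sub_le_iff.2 ⟨h x y, h y x⟩

/-- A continuous premetric: a substitute for a metric that need not be symmetric nor satisfy the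
triangle inequality, but is continuous and separates points. -/
structure IsContinuousPremetric (D : Y → Y → ℝ) : Prop where
  nonneg : ∀ x y, 0 ≤ D x y
  eq_of_eq_zero : ∀ x y, D x y = 0 → x = y
  continuous : Continuous fun z : Y × Y => D z.1 z.2

variable [CompactSpace Y]

theorem isBounded_range_continuousMap (g : C(Y, ℝ)) : Bornology.IsBounded (Set.range g) :=
  (isCompact_range g.continuous).isBounded

theorem dist_le_rangeDiam {g : C(Y, ℝ)} {a b : ℝ} (ha : a ∈ convexHull ℝ (Set.range g))
    (hb : b ∈ convexHull ℝ (Set.range g)) : dist a b ≤ rangeDiam g := by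
  rw [rangeDiam, ← convexHull_diam]
  exact Metric.dist_le_diam_of_mem
    (isBounded_convexHull.2 (isBounded_range_continuousMap g)) ha hb

theorem abs_sub_le_rangeDiam (g : C(Y, ℝ)) (x y : Y) : |g x - g y| ≤ rangeDiam g :=
  Metric.dist_le_diam_of_mem (isBounded_range_continuousMap g) ⟨x, rfl⟩ ⟨y, rfl⟩

theorem sub_le_rangeDiam (g : C(Y, ℝ)) (x y : Y) : g x - g y ≤ rangeDiam g :=
  (le_abs_self _).trans (abs_sub_le_rangeDiam g x y)

theorem rangeDiam_mono {f g : C(Y, ℝ)} (h : Set.range f ⊆ convexHull ℝ (Set.range g)) :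
    rangeDiam f ≤ rangeDiam g := by
  rw [rangeDiam, rangeDiam, ← convexHull_diam (Set.range g)]
  exact Metric.diam_mono h (isBounded_convexHull.2 (isBounded_range_continuousMap g))

theorem exists_tendsto_const_of_antitone_convexHull [Nonempty Y] {G : ℕ → C(Y, ℝ)}
    (hanti : Antitone fun N => convexHull ℝ (Set.range (G N)))
    (hdiam : Tendsto (fun N => rangeDiam (G N)) atTop (𝓝 0)) :
    ∃ c : ℝ, Tendsto G atTop (𝓝 (ContinuousMap.const Y c)) := by
  obtain ⟨y₀⟩ := ‹Nonempty Y›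
  have hmem : ∀ {N M}, N ≤ M → ∀ y, G M y ∈ convexHull ℝ (Set.range (G N)) := fun hNM y =>
    hanti hNM (subset_convexHull ℝ _ ⟨y, rfl⟩)
  obtain ⟨c, hc⟩ := cauchySeq_tendsto_of_complete (cauchySeq_of_le_tendsto_0' _
    (fun N M hNM => dist_le_rangeDiam (hmem le_rfl y₀) (hmem hNM y₀)) hdiam)
  refine ⟨c, tendsto_iff_dist_tendsto_zero.2
    (squeeze_zero (fun _ => dist_nonneg) (fun N => ?_) hdiam)⟩
  refine (ContinuousMap.dist_le (rangeDiam_nonneg _)).2 fun y =>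
    le_of_tendsto (tendsto_const_nhds.dist hc) ?_
  filter_upwards [eventually_ge_atTop N] with M hNM
  exact dist_le_rangeDiam (hmem le_rfl y) (hmem hNM y₀)

theorem IsContinuousPremetric.exists_forall_sub_le_add_mul {D : Y → Y → ℝ}
    (hD : IsContinuousPremetric D) (g : C(Y, ℝ)) {ε : ℝ} (hε : 0 < ε) :
    ∃ M : ℝ, 0 ≤ M ∧ ∀ x y, g x - g y ≤ ε + M * D x y := by
  let far : Set (Y × Y) := {z | ε ≤ g z.1 - g z.2}
  have hfar : IsCompact far := (isClosed_le continuous_const (by fun_prop)).isCompact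
  have hpos : ∀ z ∈ far, 0 < D z.1 z.2 := fun z hz => (hD.nonneg _ _).lt_of_ne' fun h0 => by
    have hz' : ε ≤ g z.1 - g z.2 := hz
    rw [hD.eq_of_eq_zero _ _ h0, sub_self] at hz'
    exact hz'.not_gt hε
  obtain ⟨d, hd, hdD⟩ := hfar.exists_forall_le' hD.continuous.continuousOn hpos
  refine ⟨rangeDiam g / d, div_nonneg (rangeDiam_nonneg g) hd.le, fun x y => ?_⟩
  by_cases hxy : (x, y) ∈ far
  · calc g x - g y ≤ rangeDiam g / d * d := by
          rw [div_mul_cancel₀ _ hd.ne']; exact sub_le_rangeDiam g x y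
      _ ≤ rangeDiam g / d * D x y := by
          gcongr
          · exact div_nonneg (rangeDiam_nonneg g) hd.le
          · exact hdD _ hxy
      _ ≤ ε + rangeDiam g / d * D x y := le_add_of_nonneg_left hε.le
  · have hlt : g x - g y < ε := not_le.1 hxy
    exact hlt.le.trans (le_add_of_nonneg_right
      (mul_nonneg (div_nonneg (rangeDiam_nonneg g) hd.le) (hD.nonneg x y)))

theorem IsContinuousPremetric.exists_forall_iterate_le {D : Y → Y → ℝ}
    (hD : IsContinuousPremetric D) {T : Y → Y} {ρ : ℝ} (hρ₀ : 0 ≤ ρ) (hρ : ρ < 1)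
    (hT : ∀ x y, D (T x) (T y) ≤ ρ * D x y) {ε : ℝ} (hε : 0 < ε) :
    ∃ k, ∀ x y, D (T^[k] x) (T^[k] y) ≤ ε := by
  obtain ⟨B, hB⟩ := (isCompact_range hD.continuous).bddAbove
  have hiter : ∀ k x y, D (T^[k] x) (T^[k] y) ≤ ρ ^ k * B := fun k => by
    induction k with
    | zero => exact fun x y => (hB ⟨(x, y), rfl⟩).trans_eq (by simp)
    | succ k ih =>
      intro x y
      rw [Function.iterate_succ_apply', Function.iterate_succ_apply', pow_succ', mul_assoc]
      exact (hT _ _).trans (mul_le_mul_of_nonneg_left (ih x y) hρ₀)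
  have hlim : Tendsto (fun k => ρ ^ k * B) atTop (𝓝 0) := by
    simpa using (tendsto_pow_atTop_nhds_zero_of_lt_one hρ₀ hρ).mul_const B
  obtain ⟨k, hk⟩ := (hlim.eventually_le_const hε).exists
  exact ⟨k, fun x y => (hiter k x y).trans hk⟩

end RangeDiam

/-- An iterated function system with place-dependent probabilities: at the state `y`, the map
with index `i` is applied with probability `weight i y`. -/
structure PlaceDependentIFS (ι Y : Type*) [Fintype ι] [TopologicalSpace Y] where
  map : ι → C(Y, Y)
  weight : ι → C(Y, ℝ)
  weight_nonneg : ∀ i y, 0 ≤ weight i y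
  sum_weight : ∀ y, ∑ i, weight i y = 1

namespace PlaceDependentIFS

section Transfer

variable {ι Y : Type*} [Fintype ι] [TopologicalSpace Y]

/-- The transfer operator, which sends `g` to the expected value of `g` after one step. -/
def transfer (S : PlaceDependentIFS ι Y) (g : C(Y, ℝ)) : C(Y, ℝ) :=
  ∑ i, S.weight i * g.comp (S.map i)

theorem transfer_apply (S : PlaceDependentIFS ι Y) (g : C(Y, ℝ)) (y : Y) :
    S.transfer g y = ∑ i, S.weight i y * g (S.map i y) := by
  simp [transfer]

theorem weight_le_one (S : PlaceDependentIFS ι Y) (i : ι) (y : Y) : S.weight i y ≤ 1 :=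
  (Finset.single_le_sum (fun k _ => S.weight_nonneg k y) (Finset.mem_univ i)).trans_eq
    (S.sum_weight y)

theorem range_transfer_subset_convexHull (S : PlaceDependentIFS ι Y) (g : C(Y, ℝ)) :
    Set.range (S.transfer g) ⊆ convexHull ℝ (Set.range g) := by
  rintro _ ⟨y, rfl⟩
  rw [transfer_apply]
  exact (convex_convexHull ℝ _).sum_mem (fun i _ => S.weight_nonneg i y) (S.sum_weight y)
    fun i _ => subset_convexHull ℝ _ ⟨S.map i y, rfl⟩

theorem antitone_convexHull_range_iterate_transfer (S : PlaceDependentIFS ι Y) (g : C(Y, ℝ)) :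
    Antitone fun N => convexHull ℝ (Set.range (S.transfer^[N] g)) := by
  refine antitone_nat_of_succ_le fun N => convexHull_min ?_ (convex_convexHull ℝ _)
  rw [Function.iterate_succ_apply']
  exact S.range_transfer_subset_convexHull _

variable [CompactSpace Y]

theorem antitone_rangeDiam_iterate_transfer (S : PlaceDependentIFS ι Y) (g : C(Y, ℝ)) :
    Antitone fun N => rangeDiam (S.transfer^[N] g) := fun _ _ hNM =>
  rangeDiam_mono ((subset_convexHull ℝ _).trans
    (S.antitone_convexHull_range_iterate_transfer g hNM))

theorem rangeDiam_iterate_transfer_le (S : PlaceDependentIFS ι Y) (g : C(Y, ℝ)) (N : ℕ) :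
    rangeDiam (S.transfer^[N] g) ≤ rangeDiam g := by
  simpa using S.antitone_rangeDiam_iterate_transfer g N.zero_le

end Transfer

section Coupling

variable {ι Y : Type*} [Fintype ι] [TopologicalSpace Y] [CompactSpace Y]

/- Run the system independently from `x` and from `y`: with probability at least `η` both copies
apply the map `j`. -/
theorem transfer_sub_transfer_le (S : PlaceDependentIFS ι Y) (g : C(Y, ℝ)) {j : ι} {x y : Y}
    {η : ℝ} (hη : η ≤ S.weight j x * S.weight j y) :
    S.transfer g x - S.transfer g y ≤
      (1 - η) * rangeDiam g + η * (g (S.map j x) - g (S.map j y)) := by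
  let gap (i k : ι) : ℝ := rangeDiam g - (g (S.map i x) - g (S.map k y))
  have hgap : ∀ i k, 0 ≤ gap i k := fun i k => sub_nonneg.2 (sub_le_rangeDiam g _ _)
  have hcoupling : ∑ i, ∑ k, S.weight i x * S.weight k y * gap i k =
      rangeDiam g - (S.transfer g x - S.transfer g y) := by
    have hinner : ∀ i, ∑ k, S.weight k y * gap i k =
        rangeDiam g - g (S.map i x) + S.transfer g y := fun i => by
      simp only [gap, ← sub_add, mul_add, Finset.sum_add_distrib, ← Finset.sum_mul, S.sum_weight,
        one_mul, transfer_apply]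
    simp only [mul_assoc, ← Finset.mul_sum, hinner, mul_add, mul_sub, Finset.sum_add_distrib,
      Finset.sum_sub_distrib, ← Finset.sum_mul, S.sum_weight, one_mul, ← transfer_apply]
    ring
  have hj : S.weight j x * S.weight j y * gap j j ≤
      ∑ i, ∑ k, S.weight i x * S.weight k y * gap i k := by
    have hterm : ∀ i k, 0 ≤ S.weight i x * S.weight k y * gap i k := fun i k =>
      mul_nonneg (mul_nonneg (S.weight_nonneg i x) (S.weight_nonneg k y)) (hgap i k)
    exact (Finset.single_le_sum (fun k _ => hterm j k) (Finset.mem_univ j)).trans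
      (Finset.single_le_sum (fun i _ => Finset.sum_nonneg fun k _ => hterm i k)
        (Finset.mem_univ j))
  have := mul_le_mul_of_nonneg_right hη (hgap j j)
  simp only [gap] at this hj
  linarith

theorem iterate_transfer_sub_le (S : PlaceDependentIFS ι Y) (g : C(Y, ℝ)) {j : ι} {η : ℝ}
    (hη₀ : 0 ≤ η) (hη : ∀ x y, η ≤ S.weight j x * S.weight j y) (k : ℕ) (x y : Y) :
    S.transfer^[k] g x - S.transfer^[k] g y ≤
      (1 - η ^ k) * rangeDiam g + η ^ k * (g ((S.map j)^[k] x) - g ((S.map j)^[k] y)) := by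
  induction k generalizing x y with
  | zero => simp
  | succ k ih =>
    have hstep := S.transfer_sub_transfer_le (S.transfer^[k] g) (hη x y)
    have hdiam : rangeDiam (S.transfer^[k] g) ≤ rangeDiam g :=
      S.rangeDiam_iterate_transfer_le g k
    have hη₁ : η ≤ 1 := (hη x y).trans
      (mul_le_one₀ (S.weight_le_one j x) (S.weight_nonneg j y) (S.weight_le_one j y))
    simp only [Function.iterate_succ_apply' S.transfer, Function.iterate_succ_apply]
    calc S.transfer (S.transfer^[k] g) x - S.transfer (S.transfer^[k] g) y
        ≤ (1 - η) * rangeDiam g + η * ((1 - η ^ k) * rangeDiam g +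
            η ^ k * (g ((S.map j)^[k] (S.map j x)) - g ((S.map j)^[k] (S.map j y)))) :=
          hstep.trans (add_le_add (mul_le_mul_of_nonneg_left hdiam (sub_nonneg.2 hη₁))
            (mul_le_mul_of_nonneg_left (ih _ _) hη₀))
      _ = _ := by ring

end Coupling

section LasotaYorke

variable {ι Y : Type*} [Fintype ι] [TopologicalSpace Y] [CompactSpace Y]

theorem transfer_sub_le_of_sub_le (S : PlaceDependentIFS ι Y) {D : Y → Y → ℝ} {ρ κ : ℝ}
    (hmap : ∀ i x y, D (S.map i x) (S.map i y) ≤ ρ * D x y)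
    (hweight : ∀ i x y, |S.weight i x - S.weight i y| ≤ κ * D x y)
    {g : C(Y, ℝ)} {ε M : ℝ} (hM : 0 ≤ M) (hg : ∀ x y, g x - g y ≤ ε + M * D x y) (x y : Y) :
    S.transfer g x - S.transfer g y ≤
      ε + (ρ * M + Fintype.card ι * κ * rangeDiam g) * D x y := by
  have hsplit : S.transfer g x - S.transfer g y =
      ∑ i, S.weight i x * (g (S.map i x) - g (S.map i y)) +
        ∑ i, (S.weight i x - S.weight i y) * (g (S.map i y) - g y) := by
    simp only [transfer_apply, mul_sub, sub_mul, Finset.sum_sub_distrib, ← Finset.sum_mul,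
      S.sum_weight]
    ring
  have hmaps : ∑ i, S.weight i x * (g (S.map i x) - g (S.map i y)) ≤ ε + ρ * M * D x y :=
    calc ∑ i, S.weight i x * (g (S.map i x) - g (S.map i y))
        ≤ ∑ i, S.weight i x * (ε + M * (ρ * D x y)) := by
          gcongr with i
          · exact S.weight_nonneg i x
          · exact (hg _ _).trans (by gcongr; exact hmap i x y)
      _ = ε + ρ * M * D x y := by rw [← Finset.sum_mul, S.sum_weight]; ring
  have hweights : ∑ i, (S.weight i x - S.weight i y) * (g (S.map i y) - g y) ≤
      Fintype.card ι * κ * rangeDiam g * D x y :=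
    calc ∑ i, (S.weight i x - S.weight i y) * (g (S.map i y) - g y)
        ≤ ∑ _i : ι, κ * D x y * rangeDiam g := by
          refine Finset.sum_le_sum fun i _ => (le_abs_self _).trans ?_
          rw [abs_mul]
          gcongr
          · exact (abs_nonneg _).trans (hweight i x y)
          · exact hweight i x y
          · exact abs_sub_le_rangeDiam g _ _
      _ = Fintype.card ι * κ * rangeDiam g * D x y := by
          rw [Finset.sum_const, Finset.card_univ, nsmul_eq_mul]; ring
  rw [hsplit]
  linarith

theorem exists_forall_iterate_transfer_sub_le (S : PlaceDependentIFS ι Y) {D : Y → Y → ℝ}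
    (hD : IsContinuousPremetric D) {ρ κ : ℝ} (hρ : ρ < 1) (hκ : 0 ≤ κ)
    (hmap : ∀ i x y, D (S.map i x) (S.map i y) ≤ ρ * D x y)
    (hweight : ∀ i x y, |S.weight i x - S.weight i y| ≤ κ * D x y)
    (g : C(Y, ℝ)) {ε : ℝ} (hε : 0 < ε) :
    ∃ M : ℝ, 0 ≤ M ∧ ∀ N x y, S.transfer^[N] g x - S.transfer^[N] g y ≤ ε + M * D x y := by
  obtain ⟨M₀, hM₀, hgM₀⟩ := hD.exists_forall_sub_le_add_mul g hε
  let A : ℝ := Fintype.card ι * κ * rangeDiam g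
  let M : ℝ := max M₀ (A / (1 - ρ))
  have hM : 0 ≤ M := hM₀.trans (le_max_left _ _)
  have hAM : ρ * M + A ≤ M := by
    have := (div_le_iff₀ (sub_pos.2 hρ)).1 (le_max_right M₀ (A / (1 - ρ)))
    linarith
  refine ⟨M, hM, fun N => ?_⟩
  induction N with
  | zero => exact fun x y => (hgM₀ x y).trans (by gcongr; exacts [hD.nonneg x y, le_max_left _ _])
  | succ N ih =>
    intro x y
    have hdiam : rangeDiam (S.transfer^[N] g) ≤ rangeDiam g :=
      S.rangeDiam_iterate_transfer_le g N
    rw [Function.iterate_succ_apply']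
    refine (S.transfer_sub_le_of_sub_le hmap hweight hM ih x y).trans
      (add_le_add_right (mul_le_mul_of_nonneg_right ?_ (hD.nonneg x y)) ε)
    exact (add_le_add_right (mul_le_mul_of_nonneg_left hdiam (by positivity)) _).trans hAM

theorem exists_tendsto_iterate_transfer [Nonempty Y] (S : PlaceDependentIFS ι Y)
    {D : Y → Y → ℝ} (hD : IsContinuousPremetric D) {ρ κ : ℝ} (hρ₀ : 0 ≤ ρ) (hρ : ρ < 1)
    (hκ : 0 ≤ κ) (hmap : ∀ i x y, D (S.map i x) (S.map i y) ≤ ρ * D x y)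
    (hweight : ∀ i x y, |S.weight i x - S.weight i y| ≤ κ * D x y)
    {j : ι} (hpos : ∀ y, 0 < S.weight j y) (g : C(Y, ℝ)) :
    ∃ c : ℝ, Tendsto (fun N => S.transfer^[N] g) atTop (𝓝 (ContinuousMap.const Y c)) := by
  refine exists_tendsto_const_of_antitone_convexHull
    (S.antitone_convexHull_range_iterate_transfer g)
    (tendsto_zero_of_antitone_of_contracting (S.antitone_rangeDiam_iterate_transfer g)
      (fun _ => rangeDiam_nonneg _) fun ε hε => ?_)
  obtain ⟨δ, hδ, hδj⟩ := isCompact_univ.exists_forall_le'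
    (S.weight j).continuous.continuousOn fun y _ => hpos y
  obtain ⟨M, hM, hgM⟩ := S.exists_forall_iterate_transfer_sub_le hD hρ hκ hmap hweight g
    (half_pos hε)
  obtain ⟨k, hk⟩ := hD.exists_forall_iterate_le hρ₀ hρ (hmap j)
    (div_pos (half_pos hε) (by positivity : 0 < M + 1))
  refine ⟨k, (δ * δ) ^ k, by positivity, fun N => rangeDiam_le fun x y => ?_⟩
  rw [add_comm, Function.iterate_add_apply]
  refine (S.iterate_transfer_sub_le (S.transfer^[N] g) (mul_self_nonneg δ)
    (fun x y => mul_le_mul (hδj x trivial) (hδj y trivial) hδ.le (S.weight_nonneg j x)) k x y).trans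
    (add_le_add_right (mul_le_mul_of_nonneg_left ?_ (by positivity)) _)
  have hDk := (le_div_iff₀' (by positivity)).1 (hk x y)
  linarith [hgM N ((S.map j)^[k] x) ((S.map j)^[k] y),
    hD.nonneg ((S.map j)^[k] x) ((S.map j)^[k] y)]

end LasotaYorke
end PlaceDependentIFS

section MarkovOperator

variable {E : Type*} [TopologicalSpace E] [MeasurableSpace E]

theorem ext_of_forall_integral_continuousMap_eq [HasOuterApproxClosed E] [BorelSpace E]
    {μ ν : Measure E} [IsFiniteMeasure μ] [IsFiniteMeasure ν]
    (h : ∀ g : C(E, ℝ), ∫ y, g y ∂μ = ∫ y, g y ∂ν) : μ = ν :=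
  ext_of_forall_integral_eq_of_IsFiniteMeasure fun g => h g.toContinuousMap

variable {P : C(E, ℝ) → C(E, ℝ)} {L : ProbabilityMeasure E → ProbabilityMeasure E}

theorem integral_iterate_of_dual
    (hdual : ∀ β g, ∫ y, g y ∂(L β : Measure E) = ∫ y, P g y ∂(β : Measure E)) (N : ℕ)
    (β : ProbabilityMeasure E) (g : C(E, ℝ)) :
    ∫ y, g y ∂(L^[N] β : Measure E) = ∫ y, P^[N] g y ∂(β : Measure E) := by
  induction N generalizing β with
  | zero => rfl
  | succ N ih => rw [Function.iterate_succ_apply, ih, hdual, Function.iterate_succ_apply']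

variable [CompactSpace E]

theorem integrable_of_continuousMap [OpensMeasurableSpace E] (β : Measure E) [IsFiniteMeasure β]
    (g : C(E, ℝ)) : Integrable (fun y => g y) β :=
  g.continuous.integrable_of_hasCompactSupport (HasCompactSupport.of_compactSpace _)

theorem continuous_integral_continuousMap [OpensMeasurableSpace E] (β : Measure E)
    [IsFiniteMeasure β] : Continuous fun g : C(E, ℝ) => ∫ y, g y ∂β := by
  refine (LipschitzWith.of_dist_le' (K := β.real Set.univ) fun f g => ?_).continuous
  rw [dist_eq_norm, dist_eq_norm, mul_comm,
    ← integral_sub (integrable_of_continuousMap β f) (integrable_of_continuousMap β g)]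
  exact norm_integral_le_of_norm_le_const (Eventually.of_forall (f - g).norm_coe_le_norm)

theorem tendsto_integral_of_tendsto_const [OpensMeasurableSpace E] (β : Measure E)
    [IsProbabilityMeasure β] {ι : Type*} {l : Filter ι} {G : ι → C(E, ℝ)} {c : ℝ}
    (h : Tendsto G l (𝓝 (ContinuousMap.const E c))) :
    Tendsto (fun i => ∫ y, G i y ∂β) l (𝓝 c) := by
  have hlim := ((continuous_integral_continuousMap β).tendsto _).comp h
  simpa only [ContinuousMap.const_apply, integral_const, probReal_univ, one_smul,
    Function.comp_def] using hlim

variable [BorelSpace E] {c : C(E, ℝ) → ℝ}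

theorem eq_self_iff_forall_integral_eq [HasOuterApproxClosed E] [Nonempty E]
    (hdual : ∀ β g, ∫ y, g y ∂(L β : Measure E) = ∫ y, P g y ∂(β : Measure E))
    (hc : ∀ g, Tendsto (fun N => P^[N] g) atTop (𝓝 (ContinuousMap.const E (c g))))
    (β : ProbabilityMeasure E) : L β = β ↔ ∀ g, ∫ y, g y ∂(β : Measure E) = c g := by
  refine ⟨fun hβ g => ?_, fun hβ => ?_⟩
  · have hlim := tendsto_integral_of_tendsto_const (β : Measure E) (hc g)
    simp only [← integral_iterate_of_dual hdual, Function.iterate_fixed hβ] at hlim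
    exact tendsto_nhds_unique tendsto_const_nhds hlim
  · have hcP : ∀ g, c (P g) = c g := fun g => by
      have heq := tendsto_nhds_unique (hc (P g)) ((hc g).comp (tendsto_add_atTop_nat 1))
      exact DFunLike.congr_fun heq (Classical.arbitrary E)
    refine Subtype.ext (ext_of_forall_integral_continuousMap_eq (μ := (L β : Measure E))
      (ν := (β : Measure E)) fun g => ?_)
    rw [hdual, hβ, hβ, hcP]

theorem exists_forall_integral_eq_of_tendsto_const [T2Space E] [Nonempty E]
    (hdual : ∀ β g, ∫ y, g y ∂(L β : Measure E) = ∫ y, P g y ∂(β : Measure E))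
    (hc : ∀ g, Tendsto (fun N => P^[N] g) atTop (𝓝 (ContinuousMap.const E (c g)))) :
    ∃ α : ProbabilityMeasure E, ∀ g, ∫ y, g y ∂(α : Measure E) = c g := by
  let β : ProbabilityMeasure E := ⟨Measure.dirac (Classical.arbitrary E), inferInstance⟩
  let l : Ultrafilter ℕ := Ultrafilter.of atTop
  let l' : Ultrafilter (ProbabilityMeasure E) := l.map fun N => L^[N] β
  have hα : Tendsto (fun N => L^[N] β) l (𝓝 l'.lim) := l'.le_nhds_lim
  refine ⟨l'.lim, fun g => ?_⟩
  have hg := ProbabilityMeasure.tendsto_iff_forall_integral_tendsto.1 hα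
    (BoundedContinuousFunction.mkOfCompact g)
  simp only [BoundedContinuousFunction.mkOfCompact_apply, integral_iterate_of_dual hdual] at hg
  exact tendsto_nhds_unique hg
    ((tendsto_integral_of_tendsto_const _ (hc g)).mono_left (Ultrafilter.of_le atTop))

theorem exists_forall_eq_self_iff_of_tendsto_const [T2Space E] [HasOuterApproxClosed E]
    [Nonempty E]
    (hdual : ∀ β g, ∫ y, g y ∂(L β : Measure E) = ∫ y, P g y ∂(β : Measure E))
    (hc : ∀ g, Tendsto (fun N => P^[N] g) atTop (𝓝 (ContinuousMap.const E (c g)))) :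
    ∃ α : ProbabilityMeasure E,
      (∀ β, L β = β ↔ β = α) ∧ ∀ g, ∫ y, g y ∂(α : Measure E) = c g := by
  obtain ⟨α, hα⟩ := exists_forall_integral_eq_of_tendsto_const hdual hc
  refine ⟨α, fun β => ?_, hα⟩
  rw [eq_self_iff_forall_integral_eq hdual hc]
  refine ⟨fun hβ => Subtype.ext (ext_of_forall_integral_continuousMap_eq
    (μ := (β : Measure E)) (ν := (α : Measure E)) fun g => ?_), fun h => h ▸ hα⟩
  rw [hβ, hα]

end MarkovOperator

section StrongLaw

theorem ae_tendsto_zero_of_summable_integral_norm {Ω F : Type*} [MeasurableSpace Ω]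
    [NormedAddCommGroup F] {μ : Measure Ω} {Z : ℕ → Ω → F} (hint : ∀ N, Integrable (Z N) μ)
    (hsum : Summable fun N => ∫ ω, ‖Z N ω‖ ∂μ) :
    ∀ᵐ ω ∂μ, Tendsto (fun N => Z N ω) atTop (𝓝 0) := by
  have hfin : ∑' N, eLpNorm (Z N) 1 μ ≠ ∞ := by
    simp only [eLpNorm_one_eq_lintegral_enorm,
      ← ofReal_integral_norm_eq_lintegral_enorm (hint _)]
    exact hsum.tsum_ofReal_ne_top
  filter_upwards [summable_norm_of_tsum_eLpNorm_ne_top le_rfl (fun N => (hint N).1) hfin]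
    with ω hω
  exact tendsto_zero_iff_norm_tendsto_zero.2 hω.tendsto_atTop_zero

theorem tendsto_div_atTop_zero_of_tendsto_sq_div_sq {s : ℕ → ℝ} {C : ℝ}
    (hstep : ∀ K, |s (K + 1) - s K| ≤ C)
    (hsq : Tendsto (fun N : ℕ => s (N ^ 2) / (N : ℝ) ^ 2) atTop (𝓝 0)) :
    Tendsto (fun K : ℕ => s K / K) atTop (𝓝 0) := by
  have hmono : Monotone fun K : ℕ => s K + C * K := monotone_nat_of_le_succ fun K => by
    push_cast
    linarith [(abs_le.1 (hstep K)).1]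
  have hgrowth : Tendsto (fun N : ℕ => ((N : ℝ) + 1) ^ 2 / (N : ℝ) ^ 2) atTop (𝓝 1) := by
    have hlim := (tendsto_add_mul_div_add_mul_atTop_nhds (1 : ℝ) 0 1 one_ne_zero).pow 2
    simpa only [div_pow, one_pow, one_mul, zero_add, div_one, add_comm (1 : ℝ)] using hlim
  have hlim : Tendsto (fun K : ℕ => (s K + C * K) / K) atTop (𝓝 C) := by
    refine tendsto_div_of_monotone_of_exists_subseq_tendsto_div _ _ hmono fun a ha =>
      ⟨fun N => N ^ 2, ?_, tendsto_pow_atTop two_ne_zero, ?_⟩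
    · filter_upwards [hgrowth.eventually_le_const ha, eventually_gt_atTop 0] with N hN hN0
      have hpos : (0 : ℝ) < (N : ℝ) ^ 2 := by positivity
      push_cast
      exact (div_le_iff₀ hpos).1 hN
    · have hadd := hsq.add_const C
      rw [zero_add] at hadd
      refine hadd.congr' ?_
      filter_upwards [eventually_gt_atTop 0] with N hN
      push_cast
      field_simp
  have hsub := hlim.sub_const C
  rw [sub_self] at hsub
  refine hsub.congr' ?_
  filter_upwards [eventually_gt_atTop 0] with K hK
  field_simp
  ring

theorem integral_sq_sum_range_le {Ω : Type*} [MeasurableSpace Ω] {μ : Measure Ω}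
    {d : ℕ → Ω → ℝ} {V : ℝ} (hL2 : ∀ k, MemLp (d k) 2 μ) (hvar : ∀ k, ∫ ω, d k ω ^ 2 ∂μ ≤ V)
    (horth : ∀ i j, i < j → ∫ ω, d i ω * d j ω ∂μ = 0) (K : ℕ) :
    ∫ ω, (∑ k ∈ Finset.range K, d k ω) ^ 2 ∂μ ≤ V * K := by
  have hint : ∀ i j, Integrable (fun ω => d i ω * d j ω) μ := fun i j =>
    (hL2 i).integrable_mul (hL2 j)
  calc ∫ ω, (∑ k ∈ Finset.range K, d k ω) ^ 2 ∂μ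
      = ∑ i ∈ Finset.range K, ∑ j ∈ Finset.range K, ∫ ω, d i ω * d j ω ∂μ := by
        simp_rw [sq, Finset.sum_mul_sum]
        rw [integral_finsetSum _ fun i _ => integrable_finsetSum _ fun j _ => hint i j]
        exact Finset.sum_congr rfl fun i _ => integral_finsetSum _ fun j _ => hint i j
    _ = ∑ k ∈ Finset.range K, ∫ ω, d k ω * d k ω ∂μ := by
        refine Finset.sum_congr rfl fun i hi => Finset.sum_eq_single_of_mem i hi fun j _ hji => ?_
        rcases lt_or_gt_of_ne hji with h | h
        · simpa only [mul_comm] using horth j i h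
        · exact horth i j h
    _ ≤ V * K := by
        simp only [← sq]
        refine (Finset.sum_le_sum fun k _ => hvar k).trans_eq ?_
        rw [Finset.sum_const, Finset.card_range, nsmul_eq_mul, mul_comm]

theorem ae_tendsto_sum_range_div_of_orthogonal {Ω : Type*} [MeasurableSpace Ω] {μ : Measure Ω}
    [IsProbabilityMeasure μ] {d : ℕ → Ω → ℝ} {C : ℝ} (hmeas : ∀ k, Measurable (d k))
    (hbdd : ∀ k ω, |d k ω| ≤ C) (horth : ∀ i j, i < j → ∫ ω, d i ω * d j ω ∂μ = 0) :
    ∀ᵐ ω ∂μ, Tendsto (fun K : ℕ => (∑ k ∈ Finset.range K, d k ω) / K) atTop (𝓝 0) := by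
  have hL2 : ∀ k, MemLp (d k) 2 μ := fun k =>
    MemLp.of_bound (hmeas k).aestronglyMeasurable C (Eventually.of_forall (hbdd k))
  have hvar : ∀ k, ∫ ω, d k ω ^ 2 ∂μ ≤ C ^ 2 := fun k =>
    (integral_mono (hL2 k).integrable_sq (integrable_const (C ^ 2)) fun ω =>
      sq_le_sq' (abs_le.1 (hbdd k ω)).1 (abs_le.1 (hbdd k ω)).2).trans_eq (by simp)
  let Z (N : ℕ) (ω : Ω) : ℝ := ((∑ k ∈ Finset.range (N ^ 2), d k ω) / (N : ℝ) ^ 2) ^ 2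
  have hZint : ∀ N, Integrable (Z N) μ := fun N => by
    simp only [Z, div_pow]
    exact (memLp_finsetSum _ fun k _ => hL2 k).integrable_sq.div_const _
  have hZle : ∀ N, ∫ ω, ‖Z N ω‖ ∂μ ≤ C ^ 2 * (1 / (N : ℝ) ^ 2) := fun N => by
    have hsum := integral_sq_sum_range_le hL2 hvar horth (N ^ 2)
    have hnorm : ∀ ω, ‖Z N ω‖ = Z N ω := fun ω => Real.norm_of_nonneg (sq_nonneg _)
    simp only [hnorm]
    simp only [Z, div_pow, integral_div]
    push_cast at hsum
    rcases N.eq_zero_or_pos with rfl | hN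
    · simp
    · rw [div_le_iff₀ (by positivity)]
      refine hsum.trans_eq ?_
      field_simp
  have hZsum : Summable fun N => ∫ ω, ‖Z N ω‖ ∂μ :=
    ((Real.summable_one_div_nat_pow.2 one_lt_two).mul_left (C ^ 2)).of_nonneg_of_le
      (fun _ => integral_nonneg fun _ => norm_nonneg _) hZle
  filter_upwards [ae_tendsto_zero_of_summable_integral_norm hZint hZsum] with ω hω
  refine tendsto_div_atTop_zero_of_tendsto_sq_div_sq (C := C) (fun K => ?_) ?_
  · rw [Finset.sum_range_succ, add_sub_cancel_left]
    exact hbdd K ω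
  · simpa only [Z, Real.sqrt_sq_eq_abs, Real.sqrt_zero, tendsto_zero_iff_abs_tendsto_zero,
      Function.comp_def, abs_abs] using hω.sqrt

end StrongLaw

section TimeAverage

variable {E : Type*} [TopologicalSpace E]

/-- The average of `g` over the first `K` points of the sequence `y`; it is `0` for `K = 0`. -/
noncomputable def timeAverage (y : ℕ → E) (K : ℕ) (g : C(E, ℝ)) : ℝ :=
  (∑ k ∈ Finset.range K, g (y k)) / K

theorem timeAverage_sub (y : ℕ → E) (K : ℕ) (f g : C(E, ℝ)) :
    timeAverage y K (f - g) = timeAverage y K f - timeAverage y K g := by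
  simp only [timeAverage, ContinuousMap.sub_apply, Finset.sum_sub_distrib, sub_div]

theorem timeAverage_const (y : ℕ → E) {K : ℕ} (hK : K ≠ 0) (c : ℝ) :
    timeAverage y K (ContinuousMap.const E c) = c := by
  simp only [timeAverage, ContinuousMap.const_apply, Finset.sum_const, Finset.card_range,
    nsmul_eq_mul, mul_div_cancel_left₀ c (Nat.cast_ne_zero.2 hK)]

variable [CompactSpace E]

theorem abs_timeAverage_le (y : ℕ → E) (K : ℕ) (g : C(E, ℝ)) : |timeAverage y K g| ≤ ‖g‖ := by
  rw [timeAverage, abs_div, Nat.abs_cast]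
  refine div_le_of_le_mul₀ K.cast_nonneg (norm_nonneg g) ((Finset.abs_sum_le_sum_abs _ _).trans ?_)
  refine (Finset.sum_le_card_nsmul _ _ ‖g‖ fun k _ => g.norm_coe_le_norm (y k)).trans_eq ?_
  rw [Finset.card_range, nsmul_eq_mul, mul_comm]

theorem equicontinuous_timeAverage_sub (y : ℕ → E) (a : ℕ → ℝ) :
    Equicontinuous fun K g => timeAverage y K g - a K :=
  (LipschitzWith.uniformEquicontinuous _ 1 fun K => LipschitzWith.of_dist_le_mul fun f g => by
    rw [NNReal.coe_one, one_mul, dist_sub_right, Real.dist_eq, ← timeAverage_sub, dist_eq_norm]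
    exact abs_timeAverage_le y K _).equicontinuous

theorem tendsto_timeAverage_of_dense {y : ℕ → E} {I : C(E, ℝ) → ℝ} (hI : Continuous I)
    {s : Set C(E, ℝ)} (hs : Dense s)
    (h : ∀ g ∈ s, Tendsto (fun K => timeAverage y K g) atTop (𝓝 (I g))) (g : C(E, ℝ)) :
    Tendsto (fun K => timeAverage y K g) atTop (𝓝 (I g)) := by
  have hclosed := (equicontinuous_timeAverage_sub y 0).isClosed_setOfPred_tendsto (l := atTop) hI
  simp only [Pi.zero_apply, sub_zero] at hclosed
  exact hclosed.closure_subset_iff.2 h (hs g)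

theorem tendsto_timeAverage_succ_sub (y : ℕ → E) (g : C(E, ℝ)) :
    Tendsto (fun K : ℕ => (∑ k ∈ Finset.range K, g (y (k + 1))) / K - timeAverage y K g)
      atTop (𝓝 0) := by
  refine squeeze_zero_norm (fun K => ?_) (tendsto_const_div_atTop_nhds_zero_nat (‖g‖ + ‖g‖))
  rw [timeAverage, ← sub_div, ← Finset.sum_sub_distrib,
    Finset.sum_range_sub (fun k => g (y k)), norm_div, Real.norm_natCast]
  gcongr
  exact norm_sub_le_of_le (g.norm_coe_le_norm _) (g.norm_coe_le_norm _)

theorem tendsto_timeAverage_iterate_sub {y : ℕ → E} {P : C(E, ℝ) → C(E, ℝ)} {g : C(E, ℝ)}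
    (hdev : ∀ N, Tendsto (fun K : ℕ =>
      (∑ k ∈ Finset.range K, (P (P^[N] g) (y k) - P^[N] g (y (k + 1)))) / K) atTop (𝓝 0)) (N : ℕ) :
    Tendsto (fun K => timeAverage y K (P^[N] g) - timeAverage y K g) atTop (𝓝 0) := by
  induction N with
  | zero => simp
  | succ N ih =>
    have hadd := ((hdev N).add (tendsto_timeAverage_succ_sub y (P^[N] g))).add ih
    simp only [add_zero, Finset.sum_sub_distrib, sub_div, sub_add_sub_cancel] at hadd
    simpa only [Function.iterate_succ_apply', timeAverage] using hadd

theorem tendsto_timeAverage_of_tendsto_const {y : ℕ → E} {P : C(E, ℝ) → C(E, ℝ)} {g : C(E, ℝ)}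
    {c : ℝ} (hc : Tendsto (fun N => P^[N] g) atTop (𝓝 (ContinuousMap.const E c)))
    (hdev : ∀ N, Tendsto (fun K : ℕ =>
      (∑ k ∈ Finset.range K, (P (P^[N] g) (y k) - P^[N] g (y (k + 1)))) / K) atTop (𝓝 0)) :
    Tendsto (fun K => timeAverage y K g) atTop (𝓝 c) := by
  have hclosed := (equicontinuous_timeAverage_sub y fun K => timeAverage y K g)
    |>.isClosed_setOfPred_tendsto (l := atTop) (f := fun _ => 0) continuous_const
  have hconst := hclosed.mem_of_tendsto hc
    (Eventually.of_forall (tendsto_timeAverage_iterate_sub hdev))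
  have hsub := (tendsto_const_nhds (x := c)).sub hconst
  rw [sub_zero] at hsub
  refine hsub.congr' ?_
  filter_upwards [eventually_ne_atTop 0] with K hK
  rw [timeAverage_const y hK, sub_sub_cancel]

end TimeAverage

section WeightedDist

variable {X : Type*} [MetricSpace X] {m : ℕ}

/-- The weighted maximum distance `max_i r ^ i * d (x_i, y_i)` on `X ^ m`. For `r > 1` it decreases
under the coordinate shift, unlike the maximum metric. -/
noncomputable def weightedDist (r : ℝ) (x y : Fin m → X) : ℝ :=
  ‖fun i : Fin m => r ^ (i : ℕ) * dist (x i) (y i)‖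

theorem pow_mul_dist_le_weightedDist (r : ℝ) (x y : Fin m → X) (i : Fin m) :
    r ^ (i : ℕ) * dist (x i) (y i) ≤ weightedDist r x y :=
  (le_abs_self _).trans (norm_le_pi_norm (fun i : Fin m => r ^ (i : ℕ) * dist (x i) (y i)) i)

theorem weightedDist_le_iff {r : ℝ} (hr : 0 ≤ r) {x y : Fin m → X} {b : ℝ} (hb : 0 ≤ b) :
    weightedDist r x y ≤ b ↔ ∀ i : Fin m, r ^ (i : ℕ) * dist (x i) (y i) ≤ b := by
  rw [weightedDist, pi_norm_le_iff_of_nonneg hb]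
  exact forall_congr' fun i => by
    rw [Real.norm_of_nonneg (mul_nonneg (pow_nonneg hr _) dist_nonneg)]

theorem dist_le_weightedDist {r : ℝ} (hr : 1 ≤ r) (x y : Fin m → X) :
    dist x y ≤ weightedDist r x y :=
  (dist_pi_le_iff (norm_nonneg _)).2 fun i =>
    (le_mul_of_one_le_left dist_nonneg (one_le_pow₀ hr)).trans
      (pow_mul_dist_le_weightedDist r x y i)

theorem isContinuousPremetric_weightedDist {r : ℝ} (hr : r ≠ 0) :
    IsContinuousPremetric (weightedDist (X := X) (m := m) r) where
  nonneg _ _ := norm_nonneg _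
  eq_of_eq_zero x y h := funext fun i => by
    have hi := congrFun (norm_eq_zero.1 h) i
    exact dist_eq_zero.1 ((mul_eq_zero.1 hi).resolve_left (pow_ne_zero _ hr))
  continuous := by unfold weightedDist; fun_prop

end WeightedDist

theorem exists_one_lt_pow_mul_le_one (m : ℕ) {q : ℝ} (hq : q < 1) :
    ∃ r > 1, r ^ m * q ≤ 1 := by
  have hlim : Tendsto (fun r : ℝ => r ^ m * q) (𝓝 1) (𝓝 (1 ^ m * q)) :=
    Continuous.tendsto (by fun_prop) 1
  rw [one_pow, one_mul] at hlim
  obtain ⟨r, hr, hr1⟩ := (((hlim.mono_left nhdsWithin_le_nhds).eventually_le_const hq).and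
    (self_mem_nhdsWithin (s := Set.Ioi 1))).exists
  exact ⟨r, hr1, hr⟩

namespace GIFSpdp

variable {X : Type*} [MetricSpace X] {m n : ℕ}

section Extension

/-- The extension of `S` to an iterated function system on `X ^ m`. -/
def extension (S : GIFSpdp X m n) : PlaceDependentIFS (Fin n) (Fin m → X) where
  map j := ⟨S.extMap j, S.continuous_extMap j⟩
  weight := S.p
  weight_nonneg j x := (S.p_mem j x).1
  sum_weight := S.p_sum

theorem extension_transfer (S : GIFSpdp X m n) : S.extension.transfer = S.extTransfer :=
  rfl

theorem weightedDist_extMap_le (S : GIFSpdp X m n) {j : Fin n} {q : ℝ≥0}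
    (hφ : LipschitzWith q (S.φ j)) {r : ℝ} (hr : 1 ≤ r) (hrq : r ^ m * q ≤ 1)
    (x y : Fin m → X) :
    weightedDist r (S.extMap j x) (S.extMap j y) ≤ r⁻¹ * weightedDist r x y := by
  have hr₀ : 0 < r := zero_lt_one.trans_le hr
  refine (weightedDist_le_iff hr₀.le (mul_nonneg (by positivity) (norm_nonneg _))).2 fun i => ?_
  rw [le_inv_mul_iff₀ hr₀, ← mul_assoc, ← pow_succ']
  unfold extMap
  split_ifs with hi
  · exact pow_mul_dist_le_weightedDist r x y ⟨i + 1, hi⟩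
  · have him : (i : ℕ) + 1 = m := by omega
    rw [him]
    calc r ^ m * dist (S.φ j x) (S.φ j y) ≤ r ^ m * (q * weightedDist r x y) := by
          gcongr
          exact (hφ.dist_le_mul x y).trans (by gcongr; exact dist_le_weightedDist hr x y)
      _ = r ^ m * q * weightedDist r x y := (mul_assoc _ _ _).symm
      _ ≤ weightedDist r x y := mul_le_of_le_one_left (norm_nonneg _) hrq

theorem exists_tendsto_iterate_extTransfer [CompactSpace X] [Nonempty X] (S : GIFSpdp X m n)
    {q K : ℝ≥0} (hq : q < 1) (hφ : ∀ j, LipschitzWith q (S.φ j))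
    (hp : ∀ j, LipschitzWith K (S.p j)) {j : Fin n} (hpos : ∀ x, 0 < S.p j x)
    (g : C(Fin m → X, ℝ)) :
    ∃ c : ℝ, Tendsto (fun N => S.extTransfer^[N] g) atTop (𝓝 (ContinuousMap.const _ c)) := by
  obtain ⟨r, hr, hrq⟩ := exists_one_lt_pow_mul_le_one m (NNReal.coe_lt_one.2 hq)
  have hr₀ : 0 < r := zero_lt_one.trans hr
  rw [← extension_transfer]
  exact S.extension.exists_tendsto_iterate_transfer (isContinuousPremetric_weightedDist hr₀.ne')
    (inv_nonneg.2 hr₀.le) (inv_lt_one_of_one_lt₀ hr) K.coe_nonneg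
    (fun i => S.weightedDist_extMap_le (hφ i) hr.le hrq)
    (fun i x y => ((hp i).dist_le_mul x y).trans
      (mul_le_mul_of_nonneg_left (dist_le_weightedDist hr.le x y) K.coe_nonneg)) hpos g

end Extension

section Marginals

variable [CompactSpace X] [MeasurableSpace X] [BorelSpace X]

theorem map_eval_succ_of_extMarkov_eq_self (S : GIFSpdp X m n)
    {α : ProbabilityMeasure (Fin m → X)} (hα : S.extMarkov α = α) {i : ℕ} (hi : i + 1 < m) :
    (α : Measure (Fin m → X)).map (fun z => z ⟨i + 1, hi⟩) =
      (α : Measure (Fin m → X)).map (fun z => z ⟨i, by omega⟩) := by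
  refine ext_of_forall_integral_continuousMap_eq fun f => ?_
  let g : C(Fin m → X, ℝ) := f.comp ⟨fun z => z ⟨i, by omega⟩, by fun_prop⟩
  have hg : ∀ z, S.extTransfer g z = f (z ⟨i + 1, hi⟩) := fun z => by
    simp [extTransfer_apply, g, extMap, hi, ← Finset.sum_mul, S.p_sum]
  rw [integral_map (measurable_pi_apply _).aemeasurable f.continuous.aestronglyMeasurable,
    integral_map (measurable_pi_apply _).aemeasurable f.continuous.aestronglyMeasurable]
  calc ∫ z, f (z ⟨i + 1, hi⟩) ∂(α : Measure (Fin m → X))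
      = ∫ z, S.extTransfer g z ∂(α : Measure (Fin m → X)) := by simp only [hg]
    _ = ∫ z, g z ∂(α : Measure (Fin m → X)) := by rw [← integral_extMarkov, hα]

theorem map_eval_eq_of_extMarkov_eq_self (S : GIFSpdp X m n)
    {α : ProbabilityMeasure (Fin m → X)} (hα : S.extMarkov α = α) (hm : 0 < m) (i : Fin m) :
    (α : Measure (Fin m → X)).map (fun z => z i) =
      (α : Measure (Fin m → X)).map (fun z => z ⟨0, hm⟩) := by
  obtain ⟨i, hi⟩ := i
  induction i with
  | zero => rfl
  | succ i ih => exact (S.map_eval_succ_of_extMarkov_eq_self hα hi).trans (ih _)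

end Marginals

section SymbolSequence

theorem integral_symbolLaw (S : GIFSpdp X m n) (x : Fin m → X) (h : Fin n → ℝ) :
    ∫ j, h j ∂(S.symbolLaw x) = ∑ j, S.p j x * h j := by
  rw [integral_fintype .of_finite]
  refine Finset.sum_congr rfl fun j _ => ?_
  rw [measureReal_def, symbolLaw_singleton, ENNReal.toReal_ofReal (S.p_mem j x).1, smul_eq_mul]

theorem block_extendWord_frestrictLe (S : GIFSpdp X m n) (x : Fin m → X) (w : ℕ → Fin n)
    {a k : ℕ} (hk : k ≤ a + 1) :
    S.block x (extendWord (Preorder.frestrictLe (π := fun _ => Fin n) a w)) k = S.block x w k :=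
  S.block_congr x k fun l hl => by simp [extendWord, show l ≤ a by omega]

theorem integral_frestrictLe_succ (S : GIFSpdp X m n) (x : Fin m → X) (a : ℕ)
    (Φ : (Finset.Iic a → Fin n) × Fin n → ℝ) :
    ∫ w, Φ (Preorder.frestrictLe a w, w (a + 1)) ∂(S.symbolMeasure x) =
      ∫ w, ∑ j, S.p j (S.block x w (a + 1)) * Φ (Preorder.frestrictLe a w, j)
        ∂(S.symbolMeasure x) := by
  let past : (ℕ → Fin n) → (Finset.Iic a → Fin n) := Preorder.frestrictLe a
  have hpast : Measurable past := by fun_prop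
  have hlaw : (S.symbolMeasure x).map past ⊗ₘ S.symbolKernel x a =
      (S.symbolMeasure x).map fun w => (past w, w (a + 1)) :=
    Kernel.map_frestrictLe_trajMeasure_compProd_eq_map_trajMeasure
      (X := fun _ => Fin n) (μ₀ := S.symbolLaw x) (κ := S.symbolKernel x)
  have := Measure.isProbabilityMeasure_map (μ := S.symbolMeasure x) hpast.aemeasurable
  have hkernel : ∀ v, ∫ j, Φ (v, j) ∂(S.symbolKernel x a v) =
      ∑ j, S.p j (S.block x (extendWord v) (a + 1)) * Φ (v, j) := fun v =>
    S.integral_symbolLaw _ _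
  calc ∫ w, Φ (past w, w (a + 1)) ∂(S.symbolMeasure x)
      = ∫ z, Φ z ∂((S.symbolMeasure x).map past ⊗ₘ S.symbolKernel x a) := by
        rw [hlaw, integral_map (by fun_prop) Measurable.of_discrete.aestronglyMeasurable]
    _ = ∫ v, ∑ j, S.p j (S.block x (extendWord v) (a + 1)) * Φ (v, j)
          ∂((S.symbolMeasure x).map past) := by
        simp only [Measure.integral_compProd .of_finite, hkernel]
    _ = _ := by
        rw [integral_map hpast.aemeasurable Measurable.of_discrete.aestronglyMeasurable]
        simp only [past, S.block_extendWord_frestrictLe x _ le_rfl]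

/-- The difference between the expected value of `g` after one step from the `k`-th block of the
orbit and its actual value at the next block. -/
noncomputable def deviation (S : GIFSpdp X m n) (x : Fin m → X) (g : C(Fin m → X, ℝ)) (k : ℕ)
    (w : ℕ → Fin n) : ℝ :=
  S.extTransfer g (S.block x w k) - g (S.block x w (k + 1))

theorem deviation_extendWord_frestrictLe (S : GIFSpdp X m n) (x : Fin m → X)
    (g : C(Fin m → X, ℝ)) (w : ℕ → Fin n) {a k : ℕ} (hk : k ≤ a) :
    S.deviation x g k (extendWord (Preorder.frestrictLe (π := fun _ => Fin n) a w)) =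
      S.deviation x g k w := by
  rw [deviation, S.block_extendWord_frestrictLe x w (by omega),
    S.block_extendWord_frestrictLe x w (by omega), deviation]

theorem measurable_deviation (S : GIFSpdp X m n) (x : Fin m → X) (g : C(Fin m → X, ℝ)) (k : ℕ) :
    Measurable (S.deviation x g k) := by
  have hfactor : S.deviation x g k = (fun v => S.deviation x g k (extendWord v)) ∘
      Preorder.frestrictLe (π := fun _ => Fin n) k :=
    funext fun w => (S.deviation_extendWord_frestrictLe x g w le_rfl).symm
  rw [hfactor]
  exact Measurable.of_discrete.comp (by fun_prop)

theorem integral_deviation_mul_deviation (S : GIFSpdp X m n) (x : Fin m → X)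
    (g : C(Fin m → X, ℝ)) {i k : ℕ} (hik : i < k) :
    ∫ w, S.deviation x g i w * S.deviation x g k w ∂(S.symbolMeasure x) = 0 := by
  obtain ⟨a, rfl⟩ : ∃ a, k = a + 1 := Nat.exists_eq_add_one.2 (by omega)
  let Φ (z : (Finset.Iic a → Fin n) × Fin n) : ℝ :=
    S.deviation x g i (extendWord z.1) *
      (S.extTransfer g (S.block x (extendWord z.1) (a + 1)) -
        g (S.extMap z.2 (S.block x (extendWord z.1) (a + 1))))
  have hΦ : ∀ w j, Φ (Preorder.frestrictLe a w, j) = S.deviation x g i w *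
      (S.extTransfer g (S.block x w (a + 1)) - g (S.extMap j (S.block x w (a + 1)))) :=
    fun w j => by
      simp only [Φ, S.deviation_extendWord_frestrictLe x g w (Nat.le_of_lt_succ hik),
        S.block_extendWord_frestrictLe x w le_rfl]
  have hmean : ∀ w, ∑ j, S.p j (S.block x w (a + 1)) * Φ (Preorder.frestrictLe a w, j) = 0 :=
    fun w => by
      simp only [hΦ, mul_left_comm, ← Finset.mul_sum, mul_sub, Finset.sum_sub_distrib,
        ← Finset.sum_mul, S.p_sum, one_mul, ← extTransfer_apply, sub_self]
  calc ∫ w, S.deviation x g i w * S.deviation x g (a + 1) w ∂(S.symbolMeasure x)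
      = ∫ w, Φ (Preorder.frestrictLe a w, w (a + 1)) ∂(S.symbolMeasure x) := by
        simp only [hΦ, ← block_succ, deviation]
    _ = 0 := by rw [integral_frestrictLe_succ]; simp only [hmean, integral_zero]

variable [CompactSpace X]

theorem abs_deviation_le (S : GIFSpdp X m n) (x : Fin m → X) (g : C(Fin m → X, ℝ)) (k : ℕ)
    (w : ℕ → Fin n) : |S.deviation x g k w| ≤ rangeDiam g :=
  dist_le_rangeDiam (S.extension.range_transfer_subset_convexHull g ⟨_, rfl⟩)
    (subset_convexHull ℝ _ ⟨_, rfl⟩)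

theorem ae_tendsto_sum_deviation_div (S : GIFSpdp X m n) (x : Fin m → X)
    (g : C(Fin m → X, ℝ)) :
    ∀ᵐ w ∂(S.symbolMeasure x),
      Tendsto (fun K : ℕ => (∑ k ∈ Finset.range K, S.deviation x g k w) / K) atTop (𝓝 0) :=
  ae_tendsto_sum_range_div_of_orthogonal (S.measurable_deviation x g) (S.abs_deviation_le x g)
    fun _ _ => S.integral_deviation_mul_deviation x g

theorem ae_tendsto_timeAverage_block (S : GIFSpdp X m n) (x : Fin m → X) {g : C(Fin m → X, ℝ)}
    {c : ℝ} (hc : Tendsto (fun N => S.extTransfer^[N] g) atTop (𝓝 (ContinuousMap.const _ c))) :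
    ∀ᵐ w ∂(S.symbolMeasure x),
      Tendsto (fun K => timeAverage (S.block x w) K g) atTop (𝓝 c) := by
  filter_upwards [ae_all_iff.2 fun N => S.ae_tendsto_sum_deviation_div x (S.extTransfer^[N] g)]
    with w hw
  exact tendsto_timeAverage_of_tendsto_const hc hw

end SymbolSequence

theorem ae_forall_tendsto_timeAverage_orbit [CompactSpace X] (hm : 0 < m)
    (S : GIFSpdp X m n) (x : Fin m → X) {I : C(X, ℝ) → ℝ} (hI : Continuous I)
    (hlim : ∀ f : C(X, ℝ), Tendsto (fun N => S.extTransfer^[N] (f.comp ⟨fun z => z ⟨0, hm⟩,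
      continuous_apply _⟩)) atTop (𝓝 (ContinuousMap.const _ (I f)))) :
    ∀ᵐ w ∂(S.symbolMeasure x), ∀ f : C(X, ℝ),
      Tendsto (fun K => timeAverage (S.orbit x w) K f) atTop (𝓝 (I f)) := by
  have hdense := TopologicalSpace.denseRange_denseSeq C(X, ℝ)
  filter_upwards [ae_all_iff.2 fun i => S.ae_tendsto_timeAverage_block x
    (hlim (TopologicalSpace.denseSeq C(X, ℝ) i))] with w hw
  exact tendsto_timeAverage_of_dense hI hdense (Set.forall_mem_range.2 hw)

end GIFSpdp

theorem LipWith.lipschitzWith {X Y : Type*} [MetricSpace X] [MetricSpace Y] {m : ℕ}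
    {a : Fin m → ℝ} {f : (Fin m → X) → Y} (h : LipWith a f) :
    LipschitzWith (∑ i, a i).toNNReal f :=
  LipschitzWith.of_dist_le' fun x y => (h.2 x y).trans <| by
    rw [Finset.sum_mul]
    gcongr with i
    · exact (h.1 i).le
    · exact dist_le_pi_dist x y i

namespace GIFSpdp

variable {X : Type*} [MetricSpace X] {m n : ℕ}

theorem E1.exists_lipschitzWith {S : GIFSpdp X m n} (h : S.E1) :
    ∃ q : ℝ≥0, q < 1 ∧ ∀ j, LipschitzWith q (S.φ j) := by
  choose a ha hsum using h
  refine ⟨Finset.univ.sup fun j => (∑ i, a j i).toNNReal,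
    (Finset.sup_lt_iff zero_lt_one).2 fun j _ => Real.toNNReal_lt_one.2 (hsum j), fun j => ?_⟩
  exact (ha j).lipschitzWith.weaken
    (Finset.le_sup (f := fun j => (∑ i, a j i).toNNReal) (Finset.mem_univ j))

theorem E2.lipschitzWith {S : GIFSpdp X m n} (h : S.E2) (j : Fin n) :
    LipschitzWith 1 (S.p j) := by
  obtain ⟨c, hc, hsum⟩ := h.2 j
  exact hc.lipschitzWith.weaken (Real.toNNReal_le_one.2 hsum.le)

theorem E2.exists_forall_p_pos {S : GIFSpdp X m n} [Nonempty X] (h : S.E2) :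
    ∃ j, ∀ x, 0 < S.p j x := by
  obtain ⟨δ, hδ, hp⟩ := h.1
  obtain ⟨j, -⟩ := Finset.nonempty_of_sum_ne_zero
    (ne_of_eq_of_ne (S.p_sum fun _ => Classical.arbitrary X) one_ne_zero)
  exact ⟨j, fun x => hδ.trans_le (hp j x)⟩

end GIFSpdp

theorem mainTheorem1_general {X : Type*} [MetricSpace X] [CompactSpace X] [Nonempty X]
    [MeasurableSpace X] [BorelSpace X] {m n : ℕ} (hm : 1 ≤ m) (S : GIFSpdp X m n)
    {q L : ℝ≥0} (hq : q < 1) (hφ : ∀ j, LipschitzWith q (S.φ j))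
    (hp : ∀ j, LipschitzWith L (S.p j)) {j : Fin n} (hpos : ∀ x, 0 < S.p j x) :
    ∃ α : ProbabilityMeasure (Fin m → X), S.IsExtendedHutchinson α ∧
      ∃ μ : ProbabilityMeasure X,
        (∀ i : Fin m, (α : Measure (Fin m → X)).map (fun z => z i) = (μ : Measure X)) ∧
        ∀ x : Fin m → X, ∃ Ω : Set (ℕ → Fin n), MeasurableSet Ω ∧ S.symbolMeasure x Ω = 1 ∧
          ∀ w ∈ Ω, ∀ f : C(X, ℝ),
            Tendsto (fun K : ℕ => (1 / (K : ℝ)) * ∑ k ∈ Finset.range K, f (S.orbit x w k))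
              atTop (𝓝 (∫ t, f t ∂(μ : Measure X))) := by
  choose c hc using S.exists_tendsto_iterate_extTransfer hq hφ hp hpos
  obtain ⟨α, hα, hαc⟩ := exists_forall_eq_self_iff_of_tendsto_const S.integral_extMarkov hc
  let proj : C(Fin m → X, X) := ⟨fun z => z ⟨0, hm⟩, continuous_apply _⟩
  let μ : ProbabilityMeasure X := α.map proj.continuous.measurable.aemeasurable
  have hμ : ∀ f : C(X, ℝ), c (f.comp proj) = ∫ t, f t ∂(μ : Measure X) := fun f =>
    (hαc _).symm.trans (integral_map proj.continuous.measurable.aemeasurable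
      f.continuous.aestronglyMeasurable).symm
  refine ⟨α, ⟨(hα α).2 rfl, fun β => (hα β).1⟩, μ,
    S.map_eval_eq_of_extMarkov_eq_self ((hα α).2 rfl) hm, fun x => ?_⟩
  have hae := S.ae_forall_tendsto_timeAverage_orbit hm x
    (continuous_integral_continuousMap (μ : Measure X)) fun f => hμ f ▸ hc _
  obtain ⟨Ω, hΩ, hΩm, hΩlim⟩ := hae.exists_measurable_mem
  refine ⟨Ω, hΩm, (mem_ae_iff_prob_eq_one hΩm).1 hΩ, fun w hw f => ?_⟩
  simpa only [one_div, inv_mul_eq_div, timeAverage] using hΩlim w hw f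

theorem mainTheorem1 {X : Type*} [MetricSpace X] [CompactSpace X] [Nonempty X]
    [MeasurableSpace X] [BorelSpace X] {m n : ℕ} (hm : 1 ≤ m)
    (S : GIFSpdp X m n) (h1 : S.E1) (h2 : S.E2) :
    ∃ α : ProbabilityMeasure (Fin m → X), S.IsExtendedHutchinson α ∧
      ∃ μ : ProbabilityMeasure X,
        (∀ i : Fin m, (α : Measure (Fin m → X)).map (fun z => z i) = (μ : Measure X)) ∧
        ∀ x : Fin m → X, ∃ Ω : Set (ℕ → Fin n), MeasurableSet Ω ∧ S.symbolMeasure x Ω = 1 ∧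
          ∀ w ∈ Ω, ∀ f : C(X, ℝ),
            Tendsto (fun K : ℕ => (1 / (K : ℝ)) * ∑ k ∈ Finset.range K, f (S.orbit x w k))
              atTop (𝓝 (∫ t, f t ∂(μ : Measure X))) := by
  obtain ⟨⟨q, hq, hφ⟩, ⟨j, hpos⟩⟩ := And.intro h1.exists_lipschitzWith h2.exists_forall_p_pos
  exact mainTheorem1_general hm S hq hφ h2.lipschitzWith hpos
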